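/- For $|q|<1$ write $(a;q)_n=\prod_{i=0}^{n-1}(1-aq^i)$ and $(a;q)_\infty=\prod_{i=0}^{\infty}(1-aq^i)$, and let $$\psi(q)=\sum_{n=1}^{\infty}\frac{q^{n^2}}{(q;q^2)_n}$$ be Ramanujan's third order mock theta function. For $n\ge 1$ let $p^o_{do}(n)$ denote the number of partitions of $n$ into an odd number of distinct parts whose smallest part is odd. Then for every complex $q$ with $|q|<1$ the product $(-q;q)_\infty$ converges unconditionally, the series $\psi(-q)$ and $\sum_{n\ge 1}p^o_{do}(n)q^n$ converge absolutely, and $$(-q;q)_\infty\,\psi(-q)=-\sum_{n\ge 1}p^o_{do}(n)\,q^n .$$ -/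

import Mathlib

/-- The finite `q`-Pochhammer symbol `(a;q)_n = (1 - a)(1 - aq) ⋯ (1 - aq^(n-1))`. -/
noncomputable def qPoch (a q : ℂ) (n : ℕ) : ℂ :=
  ∏ i ∈ Finset.range n, (1 - a * q ^ i)

/-- The infinite `q`-Pochhammer symbol `(a;q)_∞ = ∏_{n ≥ 0} (1 - aq^n)`, for `|q| < 1`. -/
noncomputable def qPochInf (a q : ℂ) : ℂ :=
  ∏' n : ℕ, (1 - a * q ^ n)

/-- The `n`-th term `q^(n^2) / (q;q^2)_n` of the series defining `ψ(q)`. -/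
noncomputable def mockPsiTerm (q : ℂ) (n : ℕ) : ℂ :=
  q ^ (n ^ 2) / qPoch q (q ^ 2) n

/-- Ramanujan's third order mock theta function `ψ(q) = ∑_{n ≥ 1} q^(n^2) / (q;q^2)_n`,
for `|q| < 1`; the sum is indexed by `n - 1`. -/
noncomputable def mockPsi (q : ℂ) : ℂ :=
  ∑' n : ℕ, mockPsiTerm q (n + 1)

/-- The partition has a smallest part (so it is not empty), and that part is odd. -/
def HasOddSmallestPart {n : ℕ} (p : n.Partition) : Prop :=
  ∃ s ∈ p.parts, Odd s ∧ ∀ t ∈ p.parts, s ≤ t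

instance decidableHasOddSmallestPart {n : ℕ} (p : n.Partition) :
    Decidable (HasOddSmallestPart p) :=
  decidable_of_iff (∃ s ∈ p.parts.toFinset, Odd s ∧ ∀ t ∈ p.parts.toFinset, s ≤ t) (by
    simp only [HasOddSmallestPart, Multiset.mem_toFinset])

/-- The number of partitions of `n` into an odd number of pairwise distinct parts
whose smallest part is odd. -/
def pdoOdd (n : ℕ) : ℕ :=
  (Finset.univ.filter fun p : n.Partition =>
    p.parts.Nodup ∧ Odd (Multiset.card p.parts) ∧ HasOddSmallestPart p).card

/-!
Both sides are expressed through finite sets `S ⊆ ℕ` weighted by `q ^ (∑ i ∈ S, i)`. Splitting off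
the element `0` and translating by `1` gives the generating function
`q ^ (k(k-1)/2) / (q;q)_k` of the sets with `k` elements (`cardGen_eq`), hence Euler's expansion of
`∏ (1 + z q ^ i)` (`hasSum_pow_mul_cardGen`). Translation by `1` also exchanges odd and even minima,
so the sets with `k ≥ 1` elements and odd minimum have generating function
`q ^ (k(k+1)/2) / ((q;q)_k (1 + q ^ k))` (`oddMinGen_mul_one_add`), and the partition series is
`R = ∑_m q ^ ((2m+1)(m+1)) / ((q;q)_{2m+1} (1 + q ^ (2m+1)))`.

It remains to see that `(q;q²)_∞ R = -ψ(-q)`, because `(-q;q)_∞ (q;q²)_∞ = 1`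
(`qPochInf_neg_mul_qPochInf_sq`). This is a limiting case of a transformation of `₃φ₂` series in
base `p = q²`: since `(q;q)_{2m+1} = (p;p)_m (q;p)_{m+1}`, the `m`-th term of `(q;p)_∞ R` contains
the infinite product `(q ^ (2m+3);p)_∞`, which Euler's expansion turns into a series over `j`. The
resulting double series (`doubleTerm`) converges absolutely, and its sum over `m + j = n` is
evaluated by the partial fraction expansion of `1 / (-q;p)_{n+1}`
(`sum_antidiagonal_partialFraction`), which gives the `n + 1`-st term of `-ψ(-q)`.
-/

/-! ### Sums over finite sets of natural numbers -/

/-- The weight `q ^ (∑ i ∈ S, i)` of a finite set `S`, read as a partition into distinct parts. -/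
noncomputable def sumWeight (q : ℂ) (S : Finset ℕ) : ℂ :=
  ∏ i ∈ S, q ^ i

/-- The translate `S + 1` of a finite set of natural numbers. -/
def shiftSucc (S : Finset ℕ) : Finset ℕ :=
  S.map ⟨Nat.succ, Nat.succ_injective⟩

/-- The smallest element of `S` exists and is odd. -/
def HasOddMin (S : Finset ℕ) : Prop :=
  ∃ s ∈ S, Odd s ∧ ∀ t ∈ S, s ≤ t

theorem sumWeight_eq_pow (q : ℂ) (S : Finset ℕ) : sumWeight q S = q ^ ∑ i ∈ S, i :=
  Finset.prod_pow_eq_pow_sum S (fun i => i) q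

theorem card_shiftSucc (S : Finset ℕ) : (shiftSucc S).card = S.card :=
  Finset.card_map _

theorem zero_notMem_shiftSucc (S : Finset ℕ) : 0 ∉ shiftSucc S := by
  simp [shiftSucc]

theorem sumWeight_shiftSucc (q : ℂ) (S : Finset ℕ) :
    sumWeight q (shiftSucc S) = q ^ S.card * sumWeight q S := by
  simp [sumWeight, shiftSucc, pow_succ, Finset.prod_mul_distrib, mul_comm]

theorem card_insert_zero_shiftSucc (S : Finset ℕ) :
    (insert 0 (shiftSucc S)).card = S.card + 1 := by
  rw [Finset.card_insert_of_notMem (zero_notMem_shiftSucc S), card_shiftSucc]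

theorem sumWeight_insert_zero_shiftSucc (q : ℂ) (S : Finset ℕ) :
    sumWeight q (insert 0 (shiftSucc S)) = q ^ S.card * sumWeight q S := by
  rw [← sumWeight_shiftSucc, sumWeight, Finset.prod_insert (zero_notMem_shiftSucc S), pow_zero,
    one_mul, sumWeight]

theorem hasOddMin_shiftSucc {S : Finset ℕ} (hS : S.Nonempty) :
    HasOddMin (shiftSucc S) ↔ ¬ HasOddMin S := by
  have hmin : ∀ t ∈ S, S.min' hS ≤ t := fun t ht => S.min'_le t ht
  have hmem := S.min'_mem hS
  constructor
  · rintro ⟨s, hs, hodd, hle⟩ ⟨u, hu, huodd, hule⟩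
    simp only [shiftSucc, Finset.mem_map, Function.Embedding.coeFn_mk] at hs hle
    obtain ⟨s', hs', rfl⟩ := hs
    have h1 := hle _ ⟨u, hu, rfl⟩
    have h2 := hule _ hs'
    have : s' = u := by simp only [Nat.succ_eq_add_one] at h1; omega
    subst this
    exact Nat.not_odd_iff_even.mpr huodd.add_one hodd
  · intro h
    refine ⟨S.min' hS + 1, ?_, ?_, ?_⟩
    · simp only [shiftSucc, Finset.mem_map, Function.Embedding.coeFn_mk]
      exact ⟨_, hmem, rfl⟩
    · have : ¬ Odd (S.min' hS) := fun ho => h ⟨_, hmem, ho, hmin⟩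
      rw [Nat.not_odd_iff_even] at this
      exact this.add_one
    · simp only [shiftSucc, Finset.mem_map, Function.Embedding.coeFn_mk]
      rintro _ ⟨t, ht, rfl⟩
      exact Nat.succ_le_succ (hmin t ht)

theorem not_hasOddMin_insert_zero (S : Finset ℕ) : ¬ HasOddMin (insert 0 S) := by
  rintro ⟨s, -, hodd, hle⟩
  have := hle 0 (Finset.mem_insert_self 0 S)
  grind

theorem bijective_shiftSucc_sumElim :
    Function.Bijective
      (Sum.elim shiftSucc fun S : Finset ℕ => insert 0 (shiftSucc S)) := by
  have hinj : Function.Injective shiftSucc := Finset.map_injective _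
  refine ⟨Function.Injective.sumElim hinj (fun S T h => hinj ?_) fun S T h => ?_, fun S => ?_⟩
  · have := congrArg (fun U : Finset ℕ => U.erase 0) h
    simpa [Finset.erase_insert, zero_notMem_shiftSucc] using this
  · exact zero_notMem_shiftSucc S (h ▸ Finset.mem_insert_self 0 _)
  · have key : shiftSucc (S.preimage Nat.succ Nat.succ_injective.injOn) = S.erase 0 := by
      ext i
      cases i <;> simp [shiftSucc]
    by_cases h0 : 0 ∈ S
    · exact ⟨.inr (S.preimage Nat.succ Nat.succ_injective.injOn), by
        simp only [Sum.elim_inr, key, Finset.insert_erase h0]⟩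
    · exact ⟨.inl (S.preimage Nat.succ Nat.succ_injective.injOn), by
        simp only [Sum.elim_inl, key, Finset.erase_eq_of_notMem h0]⟩

/-- Splitting a sum over finite sets according to whether the set contains `0`. -/
theorem tsum_finset_nat_eq {F : Finset ℕ → ℂ} (hF : Summable F) :
    ∑' S, F S = ∑' S, F (shiftSucc S) + ∑' S, F (insert 0 (shiftSucc S)) := by
  let e := Equiv.ofBijective _ bijective_shiftSucc_sumElim
  have he : Summable (F ∘ e) := e.summable_iff.mpr hF
  rw [← e.tsum_eq F]
  exact Summable.tsum_sum (f := F ∘ e) (he.comp_injective Sum.inl_injective)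
    (he.comp_injective Sum.inr_injective)

theorem summable_norm_mul_pow {q : ℂ} (hq : ‖q‖ < 1) (z : ℂ) :
    Summable fun i : ℕ => ‖z * q ^ i‖ := by
  simp only [norm_mul, norm_pow]
  exact (summable_geometric_of_lt_one (norm_nonneg q) hq).mul_left _

theorem summable_pow_card_mul_sumWeight {q : ℂ} (hq : ‖q‖ < 1) (z : ℂ) :
    Summable fun S : Finset ℕ => z ^ S.card * sumWeight q S := by
  refine (summable_finsetProd_of_summable_norm (summable_norm_mul_pow hq z)).congr fun S => ?_
  rw [Finset.prod_mul_distrib, Finset.prod_const, sumWeight]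

theorem summable_sumWeight {q : ℂ} (hq : ‖q‖ < 1) : Summable (sumWeight q) := by
  simpa using summable_pow_card_mul_sumWeight hq 1

theorem hasSum_tsum_indicator_preimage {F : Finset ℕ → ℂ} (hF : Summable F) (g : Finset ℕ → ℕ) :
    HasSum (fun k => ∑' S, (g ⁻¹' {k}).indicator F S) (∑' S, F S) := by
  simpa only [tsum_subtype] using hF.hasSum.tsum_fiberwise g

/-! ### Euler's expansion of the infinite product -/

/-- The generating function `∑ q ^ (∑ i ∈ S, i)` of the sets `S ⊆ ℕ` with `k` elements. -/
noncomputable def cardGen (q : ℂ) (k : ℕ) : ℂ :=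
  ∑' S, {S : Finset ℕ | S.card = k}.indicator (sumWeight q) S

theorem one_sub_mul_pow_ne_zero {q z : ℂ} (hq : ‖q‖ < 1) (hz : ‖z‖ < 1) (i : ℕ) :
    1 - z * q ^ i ≠ 0 := by
  intro h
  have h1 : ‖z * q ^ i‖ = 1 := by rw [← sub_eq_zero.mp h, norm_one]
  rw [norm_mul, norm_pow] at h1
  have := pow_le_one₀ (n := i) (norm_nonneg q) hq.le
  nlinarith [norm_nonneg z, norm_nonneg q]

theorem qPoch_ne_zero {q z : ℂ} (hq : ‖q‖ < 1) (hz : ‖z‖ < 1) (n : ℕ) : qPoch z q n ≠ 0 :=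
  Finset.prod_ne_zero_iff.mpr fun i _ => one_sub_mul_pow_ne_zero hq hz i

theorem qPoch_succ (a q : ℂ) (n : ℕ) : qPoch a q (n + 1) = qPoch a q n * (1 - a * q ^ n) :=
  Finset.prod_range_succ _ _

theorem qPoch_succ' (a q : ℂ) (n : ℕ) : qPoch a q (n + 1) = (1 - a) * qPoch (a * q) q n := by
  rw [qPoch, Finset.prod_range_succ', qPoch, mul_comm]
  simp [pow_succ', mul_assoc]

theorem cardGen_zero (q : ℂ) : cardGen q 0 = 1 := by
  rw [cardGen, tsum_eq_single ∅]
  · simp [sumWeight]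
  · intro S hS
    simp [Set.indicator, hS]

theorem cardGen_succ {q : ℂ} (hq : ‖q‖ < 1) (k : ℕ) :
    cardGen q (k + 1) = q ^ (k + 1) * cardGen q (k + 1) + q ^ k * cardGen q k := by
  conv_lhs => rw [cardGen, tsum_finset_nat_eq ((summable_sumWeight hq).indicator _)]
  simp only [cardGen, ← tsum_mul_left]
  congr 1 <;> refine tsum_congr fun S => ?_
  · by_cases h : S.card = k + 1 <;>
      simp [Set.indicator, card_shiftSucc, sumWeight_shiftSucc, h]
  · by_cases h : S.card = k <;>
      simp [Set.indicator, card_insert_zero_shiftSucc, sumWeight_insert_zero_shiftSucc, h]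

theorem cardGen_mul_qPoch {q : ℂ} (hq : ‖q‖ < 1) (k : ℕ) :
    cardGen q k * qPoch q q k = q ^ k.choose 2 := by
  induction k with
  | zero => simp [cardGen_zero, qPoch]
  | succ k ih =>
    rw [Nat.choose_succ_succ' k 1, Nat.choose_one_right, pow_add, ← ih, qPoch_succ]
    linear_combination qPoch q q k * cardGen_succ hq k

theorem cardGen_eq {q : ℂ} (hq : ‖q‖ < 1) (k : ℕ) :
    cardGen q k = q ^ k.choose 2 / qPoch q q k := by
  rw [eq_div_iff (qPoch_ne_zero hq hq k), cardGen_mul_qPoch hq]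

/-- Euler's expansion `∏ (1 + z q ^ i) = ∑ z ^ k q ^ (k(k-1)/2) / (q;q)_k`: grouping the sets in
`∏ (1 + z q ^ i) = ∑ z ^ |S| q ^ (∑ i ∈ S, i)` by their cardinality. -/
theorem hasSum_pow_mul_cardGen {q : ℂ} (hq : ‖q‖ < 1) (z : ℂ) :
    HasSum (fun k => z ^ k * cardGen q k) (qPochInf (-z) q) := by
  have hs := summable_pow_card_mul_sumWeight hq z
  have hprod : qPochInf (-z) q = ∑' S : Finset ℕ, z ^ S.card * sumWeight q S := by
    have h := tprod_one_add (summable_finsetProd_of_summable_norm (summable_norm_mul_pow hq z))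
    simp only [qPochInf, neg_mul, sub_neg_eq_add, h, Finset.prod_mul_distrib, Finset.prod_const,
      sumWeight]
  rw [hprod]
  convert hasSum_tsum_indicator_preimage hs Finset.card using 2 with k
  rw [cardGen, ← tsum_mul_left]
  refine tsum_congr fun S => ?_
  by_cases h : S.card = k <;> simp [Set.indicator, h]

/-! ### The generating function of the partitions -/

/-- The generating function of the sets with `k` elements whose smallest element is odd. -/
noncomputable def oddMinGen (q : ℂ) (k : ℕ) : ℂ :=
  ∑' S, {S : Finset ℕ | S.card = k ∧ HasOddMin S}.indicator (sumWeight q) S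

/-- Translation by `1` exchanges the parities of the smallest element, so that the generating
functions `o` and `e` of odd and even smallest elements satisfy `o = q ^ k * e`. -/
theorem oddMinGen_mul_one_add {q : ℂ} (hq : ‖q‖ < 1) {k : ℕ} (hk : k ≠ 0) :
    oddMinGen q k * (1 + q ^ k) = q ^ k * cardGen q k := by
  have hsum := summable_sumWeight hq
  have h : oddMinGen q k =
      ∑' S, q ^ k * {S : Finset ℕ | S.card = k ∧ ¬ HasOddMin S}.indicator (sumWeight q) S := by
    rw [oddMinGen, tsum_finset_nat_eq (hsum.indicator _)]
    have h0 : ∀ S, {S : Finset ℕ | S.card = k ∧ HasOddMin S}.indicator (sumWeight q)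
        (insert 0 (shiftSucc S)) = 0 := fun S =>
      Set.indicator_of_notMem (fun h => not_hasOddMin_insert_zero _ h.2) _
    simp only [h0, tsum_zero, add_zero]
    refine tsum_congr fun S => ?_
    by_cases hS : S.card = k
    · have hne : S.Nonempty := Finset.card_ne_zero.mp (hS ▸ hk)
      by_cases hodd : HasOddMin S <;>
        simp [Set.indicator, card_shiftSucc, sumWeight_shiftSucc, hasOddMin_shiftSucc hne, hS, hodd]
    · simp [Set.indicator, card_shiftSucc, hS]
  have hadd : cardGen q k = oddMinGen q k +
      ∑' S, {S : Finset ℕ | S.card = k ∧ ¬ HasOddMin S}.indicator (sumWeight q) S := by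
    rw [cardGen, oddMinGen, ← (hsum.indicator _).tsum_add (hsum.indicator _)]
    refine tsum_congr fun S => ?_
    by_cases hS : S.card = k <;> by_cases hodd : HasOddMin S <;> simp [Set.indicator, hS, hodd]
  rw [tsum_mul_left] at h
  linear_combination h - q ^ k * hadd

theorem hasSum_oddMinGen_odd {q : ℂ} (hq : ‖q‖ < 1) :
    HasSum (fun m => oddMinGen q (2 * m + 1))
      (∑' S, {S : Finset ℕ | Odd S.card ∧ HasOddMin S}.indicator (sumWeight q) S) := by
  convert hasSum_tsum_indicator_preimage ((summable_sumWeight hq).indicator _)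
    (fun S => S.card / 2) using 2 with m
  have h : {S : Finset ℕ | S.card = 2 * m + 1 ∧ HasOddMin S} =
      (fun S : Finset ℕ => S.card / 2) ⁻¹' {m} ∩ {S | Odd S.card ∧ HasOddMin S} := by
    ext S
    have : S.card = 2 * m + 1 ↔ S.card / 2 = m ∧ Odd S.card := by grind
    exact (and_congr_left fun _ => this).trans and_assoc
  simp only [oddMinGen, h, Set.indicator_indicator]

/-- Partitions counted by `pdoOdd n` are the finite sets of sum `n` with an odd number of elements
and odd minimum; the latter forces `0` not to be an element. -/
theorem tsum_indicator_sum_eq (q : ℂ) (n : ℕ) :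
    ∑' S, ((fun S : Finset ℕ => ∑ i ∈ S, i) ⁻¹' {n}).indicator
      ({S : Finset ℕ | Odd S.card ∧ HasOddMin S}.indicator (sumWeight q)) S =
      (pdoOdd n : ℂ) * q ^ n := by
  classical
  let A : Finset (n.Partition) := Finset.univ.filter fun p : n.Partition =>
    p.parts.Nodup ∧ Odd (Multiset.card p.parts) ∧ HasOddSmallestPart p
  have hinj : Set.InjOn (fun p : n.Partition => p.parts.toFinset) A := by
    intro p hp r hr h
    have hp' := (Finset.mem_filter.mp hp).2.1
    have hr' := (Finset.mem_filter.mp hr).2.1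
    have := congrArg Finset.val h
    simp only [Multiset.toFinset_val, hp'.dedup, hr'.dedup] at this
    exact Nat.Partition.ext this
  have hmem : ∀ S : Finset ℕ, S ∈ A.image (fun p => p.parts.toFinset) ↔
      ∑ i ∈ S, i = n ∧ Odd S.card ∧ HasOddMin S := by
    intro S
    constructor
    · intro h
      obtain ⟨p, hp, rfl⟩ := Finset.mem_image.mp h
      obtain ⟨hnd, hcard, s, hs, hodd, hle⟩ := (Finset.mem_filter.mp hp).2
      refine ⟨?_, ?_, s, by simpa using hs, hodd, fun t ht => hle t (by simpa using ht)⟩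
      · exact (Finset.sum_val _).symm.trans
          (by rw [Multiset.toFinset_val, hnd.dedup, p.parts_sum])
      · rwa [Finset.card, Multiset.toFinset_val, hnd.dedup]
    · rintro ⟨hsum, hcard, s, hs, hodd, hle⟩
      refine Finset.mem_image.mpr ⟨⟨S.val, fun {i} hi => hodd.pos.trans_le (hle i hi), ?_⟩,
        Finset.mem_filter.mpr ⟨Finset.mem_univ _, S.nodup, hcard, s, hs, hodd, hle⟩, ?_⟩
      · exact (Finset.sum_val S).trans hsum
      · simp
  rw [tsum_eq_sum (s := A.image fun p => p.parts.toFinset), 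
    Finset.sum_congr rfl (g := fun _ => q ^ n), Finset.sum_const,
    Finset.card_image_of_injOn hinj, nsmul_eq_mul]
  · rfl
  · intro S hS
    obtain ⟨h1, h2⟩ := (hmem S).mp hS
    have h3 : S ∈ (fun S : Finset ℕ => ∑ i ∈ S, i) ⁻¹' {n} := h1
    have h4 : S ∈ {S : Finset ℕ | Odd S.card ∧ HasOddMin S} := h2
    rw [Set.indicator_of_mem h3, Set.indicator_of_mem h4, sumWeight_eq_pow, h1]
  · intro S hS
    rw [hmem] at hS
    by_cases h1 : ∑ i ∈ S, i = n
    · have h2 : S ∉ {S : Finset ℕ | Odd S.card ∧ HasOddMin S} := fun h => hS ⟨h1, h⟩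
      simp only [Set.indicator_of_notMem h2, Set.indicator_apply_eq_zero, implies_true]
    · have h2 : S ∉ (fun S : Finset ℕ => ∑ i ∈ S, i) ⁻¹' {n} := h1
      exact Set.indicator_of_notMem h2 _

theorem hasSum_pdoOdd {q : ℂ} (hq : ‖q‖ < 1) :
    HasSum (fun n => (pdoOdd n : ℂ) * q ^ n)
      (∑' S, {S : Finset ℕ | Odd S.card ∧ HasOddMin S}.indicator (sumWeight q) S) := by
  simpa only [tsum_indicator_sum_eq] using
    hasSum_tsum_indicator_preimage
      ((summable_sumWeight hq).indicator {S | Odd S.card ∧ HasOddMin S})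
      fun S : Finset ℕ => ∑ i ∈ S, i

theorem pdoOdd_zero : pdoOdd 0 = 0 := by
  rw [pdoOdd, Finset.card_eq_zero, Finset.filter_eq_empty_iff]
  rintro p - ⟨-, -, s, hs, -⟩
  have h := Multiset.single_le_sum (fun _ _ => Nat.zero_le _) s hs
  have := p.parts_pos hs
  rw [p.parts_sum] at h
  omega

/-! ### Infinite products -/

theorem multipliable_one_sub_mul_pow {q : ℂ} (hq : ‖q‖ < 1) (z : ℂ) :
    Multipliable fun n : ℕ => 1 - z * q ^ n := by
  simpa only [neg_mul, ← sub_eq_add_neg] using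
    multipliable_one_add_of_summable (summable_norm_mul_pow hq (-z))

theorem qPochInf_ne_zero {q z : ℂ} (hq : ‖q‖ < 1) (hz : ‖z‖ < 1) : qPochInf z q ≠ 0 := by
  have := tprod_one_add_ne_zero_of_summable (f := fun n : ℕ => -z * q ^ n)
    (fun n => by simpa [← sub_eq_add_neg] using one_sub_mul_pow_ne_zero hq hz n)
    (summable_norm_mul_pow hq (-z))
  simpa only [neg_mul, ← sub_eq_add_neg, qPochInf] using this

theorem norm_sq_lt_one {q : ℂ} (hq : ‖q‖ < 1) : ‖q ^ 2‖ < 1 := by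
  rw [norm_pow]
  exact pow_lt_one₀ (norm_nonneg q) hq two_ne_zero

theorem qPochInf_eq_qPoch_mul {q : ℂ} (hq : ‖q‖ < 1) (z : ℂ) (n : ℕ) :
    qPochInf z q = qPoch z q n * qPochInf (z * q ^ n) q := by
  have h := Multipliable.prod_mul_tprod_nat_mul' (f := fun n : ℕ => 1 - z * q ^ n) (k := n) (by
    simpa only [pow_add, mul_assoc, mul_comm] using multipliable_one_sub_mul_pow hq (z * q ^ n))
  rw [qPochInf, ← h, qPoch, qPochInf]
  simp only [pow_add, mul_assoc, mul_comm (q ^ n)]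

/-- Euler's theorem that distinct parts and odd parts are equally numerous:
`(-q;q)_∞ = 1 / (q;q²)_∞`. -/
theorem qPochInf_neg_mul_qPochInf_sq {q : ℂ} (hq : ‖q‖ < 1) :
    qPochInf (-q) q * qPochInf q (q ^ 2) = 1 := by
  have hq2 := norm_sq_lt_one hq
  -- `(-q;q)_∞ (q;q)_∞ = (q²;q²)_∞`, and `(q;q)_∞` splits into its odd and even factors.
  have h1 : qPochInf (-q) q * qPochInf q q = qPochInf (q ^ 2) (q ^ 2) := by
    rw [qPochInf, qPochInf, ← (multipliable_one_sub_mul_pow hq (-q)).tprod_mul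
      (multipliable_one_sub_mul_pow hq q), qPochInf]
    exact tprod_congr fun n => by ring
  have h2 : qPochInf q (q ^ 2) * qPochInf (q ^ 2) (q ^ 2) = qPochInf q q := by
    have he : ∀ k : ℕ, 1 - q * q ^ (2 * k) = 1 - q * (q ^ 2) ^ k := fun k => by ring
    have ho : ∀ k : ℕ, 1 - q * q ^ (2 * k + 1) = 1 - q ^ 2 * (q ^ 2) ^ k := fun k => by ring
    have h := tprod_even_mul_odd (f := fun n : ℕ => 1 - q * q ^ n)
      ((multipliable_one_sub_mul_pow hq2 q).congr fun k => (he k).symm)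
      ((multipliable_one_sub_mul_pow hq2 (q ^ 2)).congr fun k => (ho k).symm)
    simpa only [he, ho, qPochInf] using h
  apply mul_right_cancel₀ (qPochInf_ne_zero hq2 hq2)
  rw [mul_assoc, h2, h1, one_mul]

theorem qPoch_two_mul_add_one (q : ℂ) (m : ℕ) :
    qPoch q q (2 * m + 1) = qPoch (q ^ 2) (q ^ 2) m * qPoch q (q ^ 2) (m + 1) := by
  induction m with
  | zero => simp [qPoch]
  | succ m ih =>
    rw [show 2 * (m + 1) + 1 = 2 * m + 1 + 1 + 1 by ring, qPoch_succ, qPoch_succ, ih,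
      qPoch_succ (q ^ 2), qPoch_succ q (q ^ 2) (m + 1)]
    ring

/-! ### The partial fraction expansion and the double sum -/

/-- The partial fraction expansion of `1 / (x;p)_{n+1}`. The induction on `n` uses
`1 - p ^ (m + j) = (1 - p ^ j) + p ^ j (1 - p ^ m)`, so that each side,
as a function `U_n(x)`, satisfies `(1 - p ^ (n + 1)) U_{n+1}(x) = U_n(x) - p ^ (n + 1) U_n(xp)`. -/
theorem sum_antidiagonal_partialFraction {p : ℂ} (hp : ‖p‖ < 1) (n : ℕ) {x : ℂ} (hx : ‖x‖ < 1) :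
    ∑ mj ∈ Finset.HasAntidiagonal.antidiagonal n, (-1) ^ mj.1 * p ^ (mj.1 + 1).choose 2 /
      (qPoch p p mj.1 * qPoch p p mj.2 * (1 - x * p ^ mj.1)) = 1 / qPoch x p (n + 1) := by
  induction n generalizing x with
  | zero => simp [qPoch]
  | succ n ih =>
    have hxp : ‖x * p‖ < 1 := by
      rw [norm_mul]; exact mul_lt_one_of_nonneg_of_lt_one_left (norm_nonneg _) hx hp.le
    have hP := qPoch_ne_zero hp hp
    have hS := one_sub_mul_pow_ne_zero hp hp
    have hX := one_sub_mul_pow_ne_zero hp hx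
    have hX0 : 1 - x ≠ 0 := by simpa using hX 0
    set T : ℂ → ℕ × ℕ → ℂ := fun x mj => (-1) ^ mj.1 * p ^ (mj.1 + 1).choose 2 /
      (qPoch p p mj.1 * qPoch p p mj.2 * (1 - x * p ^ mj.1)) with hT
    have hsplit : (∑ mj ∈ Finset.HasAntidiagonal.antidiagonal (n + 1), T x mj) * (1 - p ^ (n + 1)) =
        ∑ mj ∈ Finset.HasAntidiagonal.antidiagonal (n + 1), T x mj * (1 - p ^ mj.2) +
        ∑ mj ∈ Finset.HasAntidiagonal.antidiagonal (n + 1),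
          T x mj * (p ^ mj.2 * (1 - p ^ mj.1)) := by
      rw [Finset.sum_mul, ← Finset.sum_add_distrib]
      refine Finset.sum_congr rfl fun mj hmj => ?_
      rw [← Finset.HasAntidiagonal.mem_antidiagonal.mp hmj]
      ring
    have h1 : ∑ mj ∈ Finset.HasAntidiagonal.antidiagonal (n + 1), T x mj * (1 - p ^ mj.2) =
        ∑ mj ∈ Finset.HasAntidiagonal.antidiagonal n, T x mj := by
      rw [Finset.Nat.sum_antidiagonal_succ']
      simp only [pow_zero, sub_self, mul_zero, zero_add]
      refine Finset.sum_congr rfl fun mj _ => ?_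
      have := hP mj.1
      have := hP mj.2
      have := hS mj.2
      have := hX mj.1
      simp only [hT, qPoch_succ, pow_succ' p mj.2]
      field_simp
    have h2 : ∑ mj ∈ Finset.HasAntidiagonal.antidiagonal (n + 1),
        T x mj * (p ^ mj.2 * (1 - p ^ mj.1)) =
        -p ^ (n + 1) * ∑ mj ∈ Finset.HasAntidiagonal.antidiagonal n, T (x * p) mj := by
      rw [Finset.Nat.sum_antidiagonal_succ, Finset.mul_sum]
      simp only [pow_zero, sub_self, mul_zero, zero_add]
      refine Finset.sum_congr rfl fun mj hmj => ?_
      rw [← Finset.HasAntidiagonal.mem_antidiagonal.mp hmj]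
      have := hP mj.1
      have := hP mj.2
      have := hS mj.1
      have h4 := hX (mj.1 + 1)
      have h5 : x * p * p ^ mj.1 = x * p ^ (mj.1 + 1) := by ring
      simp only [hT, qPoch_succ, h5, Nat.choose_succ_succ' (mj.1 + 1) 1, Nat.choose_one_right]
      have h6 : 1 - p ^ (mj.1 + 1) = 1 - p * p ^ mj.1 := by ring
      rw [h6, pow_add p (mj.1 + 1) (Nat.choose _ _)]
      field_simp
      ring
    have hne : 1 - p ^ (n + 1) ≠ 0 := by simpa [pow_succ'] using hS n
    apply mul_right_cancel₀ hne
    rw [hsplit, h1, h2, ih hx, ih hxp, qPoch_succ x p (n + 1)]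
    have h3 := qPoch_succ x p (n + 1)
    rw [qPoch_succ' x p (n + 1)] at h3
    have hQ' := qPoch_ne_zero hp hxp (n + 1)
    have hXn := hX (n + 1)
    have h7 : 1 / qPoch (x * p) p (n + 1) =
        (1 - x) / (qPoch x p (n + 1) * (1 - x * p ^ (n + 1))) := by
      rw [← h3]; field_simp
    have h8 : 1 / qPoch x p (n + 1) =
        (1 - x * p ^ (n + 1)) / (qPoch x p (n + 1) * (1 - x * p ^ (n + 1))) := by field_simp
    rw [h7, h8]
    ring

/-- Multiplying by `(q;q²)_∞` cancels the odd factors of `(q;q)_{2m+1}`. -/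
theorem oddMinGen_odd_mul_qPochInf {q : ℂ} (hq : ‖q‖ < 1) (m : ℕ) :
    oddMinGen q (2 * m + 1) * qPochInf q (q ^ 2) =
      q ^ ((2 * m + 1) * (m + 1)) / (qPoch (q ^ 2) (q ^ 2) m * (1 + q ^ (2 * m + 1))) *
        qPochInf (q ^ (2 * m + 3)) (q ^ 2) := by
  have hq2 := norm_sq_lt_one hq
  have hne : 1 + q ^ (2 * m + 1) ≠ 0 := by
    simpa [pow_succ'] using one_sub_mul_pow_ne_zero (z := -q) hq (by simpa using hq) (2 * m)
  have h := oddMinGen_mul_one_add hq (k := 2 * m + 1) (by simp)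
  have h1 := qPoch_ne_zero hq2 hq2 m
  have h2 := qPoch_ne_zero hq2 hq (m + 1)
  have hc : (2 * m + 1).choose 2 = (2 * m + 1) * m := by
    rw [Nat.choose_two_right, Nat.add_sub_cancel, mul_left_comm,
      Nat.mul_div_cancel_left _ two_pos]
  rw [cardGen_eq hq, qPoch_two_mul_add_one, hc, ← eq_div_iff hne] at h
  rw [h, qPochInf_eq_qPoch_mul hq2 q (m + 1),
    show q * (q ^ 2) ^ (m + 1) = q ^ (2 * m + 3) by ring]
  field_simp
  ring

/-- The terms of the double series whose row sums give the partition side and whose antidiagonal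
sums give the mock theta side. -/
noncomputable def doubleTerm (q : ℂ) (mj : ℕ × ℕ) : ℂ :=
  q ^ ((2 * mj.1 + 1) * (mj.1 + 1)) / (qPoch (q ^ 2) (q ^ 2) mj.1 * (1 + q ^ (2 * mj.1 + 1))) *
    ((-q ^ (2 * mj.1 + 3)) ^ mj.2 * cardGen (q ^ 2) mj.2)

theorem pow_two_mul_choose (q : ℂ) (m : ℕ) : (q ^ 2) ^ (m + 1).choose 2 = q ^ (m * (m + 1)) := by
  rw [← pow_mul, Nat.choose_two_right, Nat.add_sub_cancel,
    Nat.mul_div_cancel' (by rw [mul_comm]; exact (Nat.even_mul_succ_self m).two_dvd), mul_comm]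

theorem summable_doubleTerm {q : ℂ} (hq : ‖q‖ < 1) : Summable (doubleTerm q) := by
  have hq2 := norm_sq_lt_one hq
  have hG := fun z => (hasSum_pow_mul_cardGen hq2 z).summable.norm
  have hmaj := ((hG 1).mul_left (1 - ‖q‖)⁻¹).mul_of_nonneg (hG (q ^ 3))
    (fun m => by have : 0 ≤ 1 - ‖q‖ := by linarith
                 positivity) fun _ => norm_nonneg _
  -- The only factor coupling `m` and `j` is `q ^ (2 * m * j)`, of norm at most `1`; without it
  -- the series is dominated by a product of two series of Euler's type.
  refine hmaj.of_norm_bounded fun mj => ?_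
  obtain ⟨m, j⟩ := mj
  have hle : ∀ n : ℕ, ‖q‖ ^ n ≤ 1 := fun n => pow_le_one₀ (norm_nonneg q) hq.le
  rw [doubleTerm, norm_mul]
  gcongr
  · have h1 : q ^ ((2 * m + 1) * (m + 1)) / (qPoch (q ^ 2) (q ^ 2) m * (1 + q ^ (2 * m + 1))) =
        q ^ (m ^ 2 + 4 * m + 1) * (1 + q ^ (2 * m + 1))⁻¹ * (1 ^ m * cardGen (q ^ 2) m) := by
      rw [cardGen_eq hq2]
      cases m with
      | zero => simp [qPoch]; ring
      | succ m => rw [pow_two_mul_choose, div_eq_mul_inv, mul_inv]; ring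
    have h2 : 1 - ‖q‖ ≤ ‖1 + q ^ (2 * m + 1)‖ := by
      have h3 := norm_sub_norm_le (1 : ℂ) (-q ^ (2 * m + 1))
      rw [norm_one, norm_neg, norm_pow, sub_neg_eq_add, pow_succ] at h3
      nlinarith [hle (2 * m), norm_nonneg q]
    dsimp only
    rw [h1, norm_mul, norm_mul, norm_inv, norm_pow]
    gcongr
    calc ‖q‖ ^ (m ^ 2 + 4 * m + 1) * ‖1 + q ^ (2 * m + 1)‖⁻¹
        ≤ 1 * (1 - ‖q‖)⁻¹ := by
          have : 0 < 1 - ‖q‖ := by linarith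
          gcongr
          exact hle _
      _ = _ := one_mul _
  · dsimp only
    rw [norm_mul, norm_mul, norm_pow, norm_pow, norm_neg, norm_pow, norm_pow]
    have h3 : ‖q‖ ^ (2 * m + 3) ≤ ‖q‖ ^ 3 :=
      pow_le_pow_of_le_one (norm_nonneg q) hq.le (by omega)
    gcongr

theorem sum_antidiagonal_doubleTerm {q : ℂ} (hq : ‖q‖ < 1) (n : ℕ) :
    ∑ mj ∈ Finset.HasAntidiagonal.antidiagonal n, doubleTerm q mj = -mockPsiTerm (-q) (n + 1) := by
  have hq2 := norm_sq_lt_one hq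
  have hx : ‖-q‖ < 1 := by simpa using hq
  have hsign : -mockPsiTerm (-q) (n + 1) =
      (-1) ^ n * q ^ ((n + 1) ^ 2) * (1 / qPoch (-q) (q ^ 2) (n + 1)) := by
    have : (-1 : ℂ) ^ ((n + 1) ^ 2) = (-1) ^ (n + 1) := by
      rcases Nat.even_or_odd (n + 1) with h | h
      · rw [h.neg_one_pow, (h.pow_of_ne_zero two_ne_zero).neg_one_pow]
      · rw [h.neg_one_pow, h.pow.neg_one_pow]
    rw [mockPsiTerm, neg_pow q, this, neg_sq]
    ring
  rw [hsign, ← sum_antidiagonal_partialFraction hq2 n hx, Finset.mul_sum]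
  refine Finset.sum_congr rfl fun mj hmj => ?_
  obtain ⟨m, j⟩ := mj
  obtain rfl : m + j = n := Finset.HasAntidiagonal.mem_antidiagonal.mp hmj
  have hden : 1 - -q * (q ^ 2) ^ m = 1 + q ^ (2 * m + 1) := by ring
  have hj : (q ^ 2) ^ j.choose 2 * q ^ j = q ^ (j ^ 2) := by
    cases j with
    | zero => simp
    | succ j => rw [pow_two_mul_choose]; ring
  have h1 : ((-1 : ℂ) ^ m) * (-1) ^ m = 1 := by rw [← mul_pow]; simp
  have hexp : q ^ ((2 * m + 1) * (m + 1)) * (q ^ (2 * m + 3)) ^ j * (q ^ 2) ^ j.choose 2 =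
      q ^ ((m + j + 1) ^ 2) * q ^ (m * (m + 1)) := by
    have : (q ^ (2 * m + 3)) ^ j = q ^ ((2 * m + 2) * j) * q ^ j := by ring
    rw [this, mul_assoc, mul_assoc, mul_comm (q ^ j), hj]
    ring
  dsimp only [doubleTerm]
  rw [hden, pow_two_mul_choose, cardGen_eq hq2, neg_pow (q ^ (2 * m + 3)) j]
  calc _ = (-1) ^ j * (q ^ ((2 * m + 1) * (m + 1)) * (q ^ (2 * m + 3)) ^ j *
        (q ^ 2) ^ j.choose 2) /
        (qPoch (q ^ 2) (q ^ 2) m * qPoch (q ^ 2) (q ^ 2) j * (1 + q ^ (2 * m + 1))) := by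
          simp only [div_eq_mul_inv, mul_inv]
          ring
    _ = _ := by
      rw [hexp]
      linear_combination (-(-1) ^ j * (q ^ ((m + j + 1) ^ 2) * q ^ (m * (m + 1))) /
        (qPoch (q ^ 2) (q ^ 2) m * qPoch (q ^ 2) (q ^ 2) j * (1 + q ^ (2 * m + 1)))) * h1

theorem hasSum_mockPsiTerm_neg {q : ℂ} (hq : ‖q‖ < 1) :
    HasSum (fun n => mockPsiTerm (-q) (n + 1)) (-∑' mj, doubleTerm q mj) := by
  have h := (Finset.HasAntidiagonal.sigmaAntidiagonalEquivProd.hasSum_iff.mpr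
    (summable_doubleTerm hq).hasSum).sigma fun n => hasSum_fintype _
  have hterm : (fun n => mockPsiTerm (-q) (n + 1)) = fun n =>
      -∑ mj : Finset.HasAntidiagonal.antidiagonal n, doubleTerm q mj := by
    funext n
    rw [Finset.sum_coe_sort, sum_antidiagonal_doubleTerm hq, neg_neg]
  rw [hterm]
  exact h.neg

theorem hasSum_oddMinGen_odd_mul {q : ℂ} (hq : ‖q‖ < 1) :
    HasSum (fun m => oddMinGen q (2 * m + 1) * qPochInf q (q ^ 2)) (∑' mj, doubleTerm q mj) := by
  refine (summable_doubleTerm hq).hasSum.prod_fiberwise fun m => ?_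
  rw [oddMinGen_odd_mul_qPochInf hq]
  have := hasSum_pow_mul_cardGen (norm_sq_lt_one hq) (-q ^ (2 * m + 3))
  rw [neg_neg] at this
  simpa only [doubleTerm] using this.mul_left _

theorem theorem1p6 (q : ℂ) (hq : ‖q‖ < 1) :
    Multipliable (fun n : ℕ => 1 - (-q) * q ^ n) ∧
    Summable (fun n : ℕ => mockPsiTerm (-q) (n + 1)) ∧
    Summable (fun n : ℕ => (pdoOdd (n + 1) : ℂ) * q ^ (n + 1)) ∧
    qPochInf (-q) q * mockPsi (-q) =
      -∑' n : ℕ, (pdoOdd (n + 1) : ℂ) * q ^ (n + 1) := by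
  have hpsi := hasSum_mockPsiTerm_neg hq
  have hpart := hasSum_pdoOdd hq
  have hpart' := (hasSum_nat_add_iff' 1).mpr hpart
  simp only [Finset.sum_range_one, pdoOdd_zero, Nat.cast_zero, zero_mul, sub_zero] at hpart'
  refine ⟨multipliable_one_sub_mul_pow hq (-q), hpsi.summable, hpart'.summable, ?_⟩
  have h := (hasSum_oddMinGen_odd_mul hq).unique ((hasSum_oddMinGen_odd hq).mul_right _)
  rw [hpart'.tsum_eq, mockPsi, hpsi.tsum_eq, h]
  linear_combination (-(∑' S, {S : Finset ℕ | Odd S.card ∧ HasOddMin S}.indicator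
    (sumWeight q) S)) * qPochInf_neg_mul_qPochInf_sq hq
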